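/- Let $\star\in\{\top,H\}$ denote either the transpose or the conjugate transpose of complex matrices; on scalars, $\lambda^\top=\lambda$ and $\lambda^H=\bar\lambda$. For $M,N\in\mathbb{C}^{n\times n}$ let $\sigma(M-\lambda N)\subseteq\mathbb{C}\cup\{\infty\}$ be the set of all $\lambda\in\mathbb{C}$ with $\det(M-\lambda N)=0$, together with $\infty$ if $\det N=0$. Write $M-\lambda N\sim M'-\lambda N'$ (spectral equivalence) if $\sigma(M-\lambda N)=\sigma(M'-\lambda N')$. A set $\Lambda\subseteq\mathbb{C}\cup\{\infty\}$ is called $\star$-reciprocal free if $\lambda\ne 1/\mu^\star$ for all $\lambda,\mu\in\Lambda$ (including $\lambda=\mu$), where $0$ and $\infty$ are regarded as reciprocals of each other. **Theorem.** Let $A,B,C\in\mathbb{C}^{n\times n}$ and $$\mathcal{Z}=\begin{bmatrix}0&B\\A&-C\end{bmatrix}\in\mathbb{C}^{2n\times 2n}.$$ Assume that $\sigma(A^\star-\lambda B)$ is $\star$-reciprocal free, and let $U_1,U_2,V_1,V_2,T_1,T_2\in\mathbb{C}^{n\times n}$ satisfy $$\mathcal{Z}^\star\begin{bmatrix}U_1\\V_1\end{bmatrix}=\begin{bmatrix}U_2\\V_2\end{bmatrix}T_1^\star,\qquad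 \mathcal{Z}\begin{bmatrix}U_1\\V_1\end{bmatrix}=\begin{bmatrix}U_2\\V_2\end{bmatrix}T_2 .$$ (i) If $T_1^\star-\lambda T_2\sim B^\star-\lambda A$, then $V_1=U_2=0$. (ii) If $T_1^\star-\lambda T_2\sim A^\star-\lambda B$ and $\begin{bmatrix}U_1\\V_1\end{bmatrix}$ has full column rank $n$, then $V_1$ is nonsingular. If, moreover, $B$ is nonsingular, then $U_2$ is nonsingular, and the matrix $$X=U_1V_1^{-1}=-U_2^{-\star}V_2^\star$$ (the second equality being part of the claim, with $U_2^{-\star}=(U_2^\star)^{-1}$) satisfies $AX+X^\star B=C$. -/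

import Mathlib

/-- The operation `⋆` on complex matrices: the transpose or the conjugate transpose. -/
inductive StarOp where
  | transpose
  | conjTranspose

namespace StarOp

/-- The action of `⋆` on matrices: `Mᵀ` or `Mᴴ`. -/
def mat {m n : Type*} : StarOp → Matrix m n ℂ → Matrix n m ℂ
  | transpose, M => M.transpose
  | conjTranspose, M => M.conjTranspose

/-- The action of `⋆` on scalars (`1 × 1` matrices): `z` or its complex conjugate. -/
def scalar : StarOp → ℂ → ℂ
  | transpose, z => z
  | conjTranspose, z => (starRingEnd ℂ) z

open Classical in
/-- The `⋆`-reciprocal `1 / μ^⋆` on `ℂ ∪ {∞}`, with `0` and `∞` reciprocals of each other. -/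
noncomputable def recip (s : StarOp) (μ : OnePoint ℂ) : OnePoint ℂ :=
  μ.elim ((0 : ℂ) : OnePoint ℂ)
    (fun z => if z = 0 then OnePoint.infty else (((s.scalar z)⁻¹ : ℂ) : OnePoint ℂ))

/-- A set of (finite or infinite) eigenvalues is `⋆`-reciprocal free if it contains no
`μ, ν` (equal or not) with `μ = 1 / ν^⋆`. -/
def ReciprocalFree (s : StarOp) (S : Set (OnePoint ℂ)) : Prop :=
  ∀ μ ∈ S, ∀ ν ∈ S, μ ≠ s.recip ν

end StarOp

/-- The spectrum `σ(A - λ B) ⊆ ℂ ∪ {∞}` of a square matrix pencil: the `z ∈ ℂ` with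
`det (A - z B) = 0`, together with `∞` when `det B = 0`. For a pencil that is not regular
this is all of `ℂ ∪ {∞}`. -/
def pencilSpectrum {n : ℕ} (A B : Matrix (Fin n) (Fin n) ℂ) : Set (OnePoint ℂ) :=
  {μ | (∃ z : ℂ, μ = (z : OnePoint ℂ) ∧ (A - z • B).det = 0) ∨
    (μ = OnePoint.infty ∧ B.det = 0)}

/-- `A - λ B` and `A' - λ B'` are spectrally equivalent: they have the same spectrum in
`ℂ ∪ {∞}` (as sets). -/
def SpectrallyEquivalent {n : ℕ} (A B A' B' : Matrix (Fin n) (Fin n) ℂ) : Prop :=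
  pencilSpectrum A B = pencilSpectrum A' B'

/-- The `2n × 2n` matrix `𝒵 = [[0, B], [A, -C]]`. -/
def zMatrix {n : ℕ} (A B C : Matrix (Fin n) (Fin n) ℂ) :
    Matrix (Fin n ⊕ Fin n) (Fin n ⊕ Fin n) ℂ :=
  Matrix.fromBlocks 0 B A (-C)

open Matrix Polynomial

/-! ### Algebra of the operation ⋆. -/

namespace StarOp

/-! Reciprocal freeness says that `A^⋆ - λB` and its ⋆-reversal `B^⋆ - λA` share no eigenvalue. The
top block rows of the hypotheses read `A^⋆V₁ = U₂T₁^⋆`, `BV₁ = U₂T₂`, a homogeneous generalized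
Sylvester system; in (i) its two pencils are spectrally disjoint, so `DisjointPencils.eq_zero` gives
`V₁ = U₂ = 0`. In (ii), a singular `V₁` would have in its kernel an eigenvector `x` of `T₁^⋆ - λT₂`;
the bottom rows then make `U₁x ≠ 0` an eigenvector of `B^⋆ - λA` for the same eigenvalue, which is
excluded. The two formulas for `X` agree because `G = U₂^⋆U₁ + V₂^⋆V₁` solves another such system
and hence vanishes. -/

theorem mat_mul {l m n : Type*} [Fintype m] (s : StarOp) (M : Matrix l m ℂ) (N : Matrix m n ℂ) :
    s.mat (M * N) = s.mat N * s.mat M := by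
  cases s
  · exact Matrix.transpose_mul M N
  · exact Matrix.conjTranspose_mul M N

theorem mat_mat {m n : Type*} (s : StarOp) (M : Matrix m n ℂ) : s.mat (s.mat M) = M := by
  cases s
  · exact Matrix.transpose_transpose M
  · exact Matrix.conjTranspose_conjTranspose M

theorem mat_add {m n : Type*} (s : StarOp) (M N : Matrix m n ℂ) :
    s.mat (M + N) = s.mat M + s.mat N := by
  cases s
  · exact Matrix.transpose_add M N
  · exact Matrix.conjTranspose_add M N

theorem mat_neg {m n : Type*} (s : StarOp) (M : Matrix m n ℂ) : s.mat (-M) = -s.mat M := by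
  cases s
  · exact Matrix.transpose_neg M
  · exact Matrix.conjTranspose_neg M

theorem mat_sub {m n : Type*} (s : StarOp) (M N : Matrix m n ℂ) :
    s.mat (M - N) = s.mat M - s.mat N := by
  rw [sub_eq_add_neg, mat_add, mat_neg, ← sub_eq_add_neg]

theorem mat_zero {m n : Type*} (s : StarOp) : s.mat (0 : Matrix m n ℂ) = 0 := by
  cases s
  · exact Matrix.transpose_zero
  · exact Matrix.conjTranspose_zero

theorem mat_smul {m n : Type*} (s : StarOp) (z : ℂ) (M : Matrix m n ℂ) :
    s.mat (z • M) = s.scalar z • s.mat M := by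
  cases s
  · exact Matrix.transpose_smul z M
  · exact Matrix.conjTranspose_smul z M

theorem mat_fromBlocks {k l m n : Type*} (s : StarOp) (A : Matrix k m ℂ) (B : Matrix k n ℂ)
    (C : Matrix l m ℂ) (D : Matrix l n ℂ) :
    s.mat (fromBlocks A B C D) = fromBlocks (s.mat A) (s.mat C) (s.mat B) (s.mat D) := by
  cases s
  · exact fromBlocks_transpose A B C D
  · exact fromBlocks_conjTranspose A B C D

theorem scalar_eq_zero_iff (s : StarOp) (z : ℂ) : s.scalar z = 0 ↔ z = 0 := by
  cases s <;> simp [scalar]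

theorem scalar_scalar (s : StarOp) (z : ℂ) : s.scalar (s.scalar z) = z := by
  cases s <;> simp [scalar]

theorem scalar_div (s : StarOp) (z w : ℂ) : s.scalar (z / w) = s.scalar z / s.scalar w := by
  cases s <;> simp [scalar]

variable {n : Type*} [Fintype n] [DecidableEq n]

theorem det_mat (s : StarOp) (M : Matrix n n ℂ) : (s.mat M).det = s.scalar M.det := by
  cases s
  · exact Matrix.det_transpose M
  · exact Matrix.det_conjTranspose M

theorem isUnit_mat (s : StarOp) {M : Matrix n n ℂ} (h : IsUnit M) : IsUnit (s.mat M) := by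
  rw [isUnit_iff_isUnit_det, isUnit_iff_ne_zero] at *
  rwa [det_mat, Ne, scalar_eq_zero_iff]

end StarOp

/-- The two pencils `P - λ Q` and `S - λ T` have no common eigenvalue in `ℂ ∪ {∞}`, in
homogeneous coordinates. -/
def DisjointPencils {n : Type*} [Fintype n] [DecidableEq n] (P Q S T : Matrix n n ℂ) : Prop :=
  ∀ a b : ℂ, (a ≠ 0 ∨ b ≠ 0) → (a • P - b • Q).det = 0 → (a • S - b • T).det ≠ 0

open Classical in
/-- The point of `ℂ ∪ {∞}` with homogeneous coordinates `(a, b)`, namely `b / a`. -/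
noncomputable def homPoint (a b : ℂ) : OnePoint ℂ :=
  if a = 0 then OnePoint.infty else ((b / a : ℂ) : OnePoint ℂ)

theorem homPoint_mem_pencilSpectrum {n : ℕ} (P Q : Matrix (Fin n) (Fin n) ℂ) {a b : ℂ}
    (h : a ≠ 0 ∨ b ≠ 0) :
    homPoint a b ∈ pencilSpectrum P Q ↔ (a • P - b • Q).det = 0 := by
  unfold homPoint pencilSpectrum
  by_cases ha : a = 0
  · have hb : b ≠ 0 := h.resolve_left (not_not.2 ha)
    simp [ha, ← neg_smul, hb, OnePoint.infty_ne_coe]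
  · have e : a • P - b • Q = a • (P - (b / a) • Q) := by
      rw [smul_sub, smul_smul, mul_div_cancel₀ b ha]
    simp [ha, e, OnePoint.coe_ne_infty]

theorem homPoint_eq_recip (s : StarOp) {a b : ℂ} (h : a ≠ 0 ∨ b ≠ 0) :
    homPoint a b = s.recip (homPoint (s.scalar b) (s.scalar a)) := by
  unfold homPoint StarOp.recip
  by_cases hb : b = 0
  · have ha : a ≠ 0 := h.resolve_right (not_not.2 hb)
    simp [hb, ha, (s.scalar_eq_zero_iff 0).2 rfl]
  · by_cases ha : a = 0
    · simp [ha, hb, s.scalar_eq_zero_iff, (s.scalar_eq_zero_iff 0).2 rfl]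
    · simp [ha, hb, s.scalar_eq_zero_iff, s.scalar_div, s.scalar_scalar]

theorem det_smul_mat_sub_smul_mat (s : StarOp) {n : Type*} [Fintype n] [DecidableEq n]
    (P Q : Matrix n n ℂ) {a b : ℂ} :
    (a • s.mat Q - b • s.mat P).det = 0 ↔ (s.scalar b • P - s.scalar a • Q).det = 0 := by
  have e : a • s.mat Q - b • s.mat P = s.mat (-(s.scalar b • P - s.scalar a • Q)) := by
    rw [neg_sub, s.mat_sub, s.mat_smul, s.mat_smul, s.scalar_scalar, s.scalar_scalar]
  rw [e, s.det_mat, s.scalar_eq_zero_iff, det_neg]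
  simp

/-- A pencil with `⋆`-reciprocal free spectrum has no eigenvalue in common with its
`⋆`-reversal. -/
theorem StarOp.ReciprocalFree.disjointPencils {s : StarOp} {n : ℕ}
    {P Q : Matrix (Fin n) (Fin n) ℂ} (h : s.ReciprocalFree (pencilSpectrum P Q)) :
    DisjointPencils P Q (s.mat Q) (s.mat P) := by
  intro a b hab h1 h2
  rw [det_smul_mat_sub_smul_mat] at h2
  have hab' : s.scalar b ≠ 0 ∨ s.scalar a ≠ 0 := by
    simpa [s.scalar_eq_zero_iff] using hab.symm
  exact h _ ((homPoint_mem_pencilSpectrum P Q hab).2 h1) _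
    ((homPoint_mem_pencilSpectrum P Q hab').2 h2) (homPoint_eq_recip s hab)

/-- The point 1 is its own ⋆-reciprocal, so it cannot be an eigenvalue. This makes the pencil
regular, with an explicit invertible member `P - Q`. -/
theorem StarOp.ReciprocalFree.det_sub_ne_zero {s : StarOp} {n : ℕ}
    {P Q : Matrix (Fin n) (Fin n) ℂ} (h : s.ReciprocalFree (pencilSpectrum P Q)) :
    (P - Q).det ≠ 0 := by
  intro h1
  have h2 : s.scalar 1 = 1 := by cases s <;> simp [StarOp.scalar]
  have h3 := h.disjointPencils 1 1 (Or.inl one_ne_zero) (by simpa using h1)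
  rw [Ne, det_smul_mat_sub_smul_mat, h2] at h3
  exact h3 (by simpa using h1)

theorem SpectrallyEquivalent.det_eq_zero_iff {n : ℕ} {P Q S T : Matrix (Fin n) (Fin n) ℂ}
    (h : SpectrallyEquivalent P Q S T) {a b : ℂ} (hab : a ≠ 0 ∨ b ≠ 0) :
    (a • P - b • Q).det = 0 ↔ (a • S - b • T).det = 0 := by
  rw [← homPoint_mem_pencilSpectrum _ _ hab, ← homPoint_mem_pencilSpectrum _ _ hab,
    show pencilSpectrum P Q = pencilSpectrum S T from h]

theorem SpectrallyEquivalent.det_sub_eq_zero_iff {n : ℕ} {P Q S T : Matrix (Fin n) (Fin n) ℂ}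
    (h : SpectrallyEquivalent P Q S T) : (P - Q).det = 0 ↔ (S - T).det = 0 := by
  simpa using h.det_eq_zero_iff (a := 1) (b := 1) (Or.inl one_ne_zero)

theorem eq_zero_of_mulVec_eq_zero_of_rank_eq_card {m n : Type*} [Fintype n] {W : Matrix m n ℂ}
    (h : W.rank = Fintype.card n) {x : n → ℂ} (hx : W *ᵥ x = 0) : x = 0 := by
  have h1 := LinearMap.finrank_range_add_finrank_ker W.mulVecLin
  have h2 : Module.finrank ℂ (LinearMap.range W.mulVecLin) = Fintype.card n := h
  rw [h2, Module.finrank_fintype_fun_eq_card, Nat.add_eq_left, Submodule.finrank_eq_zero] at h1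
  exact LinearMap.ker_eq_bot'.1 h1 x hx

/-! ### Homogeneous Sylvester equations. -/

section Sylvester

variable {n : Type*} [Fintype n] [DecidableEq n]

theorem aeval_mul_eq_mul_aeval {M N V : Matrix n n ℂ} (h : M * V = V * N) (p : ℂ[X]) :
    aeval M p * V = V * aeval N p := by
  have hpow (k : ℕ) : M ^ k * V = V * N ^ k := by
    induction k with
    | zero => simp
    | succ k ih => rw [pow_succ, Matrix.mul_assoc, h, ← Matrix.mul_assoc, ih, Matrix.mul_assoc,
        ← pow_succ]
  induction p using Polynomial.induction_on' with
  | add p q hp hq => simp [Matrix.add_mul, Matrix.mul_add, hp, hq]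
  | monomial k c => simp [aeval_monomial, ← Algebra.smul_def, hpow]

/-- A homogeneous Sylvester equation whose coefficients have no common eigenvalue has only the
trivial solution. -/
theorem eq_zero_of_mul_eq_mul {M N V : Matrix n n ℂ} (h : M * V = V * N)
    (hMN : ∀ k : ℂ, (k • (1 : Matrix n n ℂ) - M).det = 0 →
      (k • (1 : Matrix n n ℂ) - N).det ≠ 0) : V = 0 := by
  -- Spectral mapping below needs a characteristic polynomial of positive degree.
  rcases isEmpty_or_nonempty n with hn | hn
  · exact Subsingleton.elim _ _
  have hu : IsUnit (aeval M N.charpoly) := by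
    by_contra hu
    have h0 : (0 : ℂ) ∈ spectrum ℂ (aeval M N.charpoly) := (spectrum.zero_mem_iff ℂ).2 hu
    rw [spectrum.map_polynomial_aeval_of_degree_pos M _ (by
      rw [charpoly_degree_eq_dim]; exact_mod_cast Fintype.card_pos)] at h0
    obtain ⟨k, hk, hk0⟩ := h0
    rw [spectrum.mem_iff, isUnit_iff_isUnit_det, isUnit_iff_ne_zero, not_not,
      Algebra.algebraMap_eq_smul_one] at hk
    refine hMN k hk ?_
    change eval k N.charpoly = 0 at hk0
    rw [← hk0, eval_charpoly, ← Algebra.algebraMap_eq_smul_one]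
    rfl
  -- By Cayley–Hamilton, `V` is annihilated by the invertible matrix `χ_N(M)`.
  have hV := aeval_mul_eq_mul_aeval h N.charpoly
  rw [aeval_self_charpoly, Matrix.mul_zero] at hV
  exact hu.mul_right_eq_zero.1 hV

/-- A Möbius change of parameter: an eigenvalue `k` of `(P - Q)⁻¹Q` is the pencil eigenvalue `(k +
1)/k`, with `k = 0` giving ∞. Pencil equations thus become ordinary ones. -/
theorem sub_mul_smul_one_sub_inv_mul {P Q : Matrix n n ℂ} (h : (P - Q).det ≠ 0) (k : ℂ) :
    (P - Q) * (k • (1 : Matrix n n ℂ) - (P - Q)⁻¹ * Q) = k • P - (k + 1) • Q := by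
  rw [Matrix.mul_sub, mul_nonsing_inv_cancel_left _ _ (isUnit_iff_ne_zero.2 h), Matrix.mul_smul,
    Matrix.mul_one, smul_sub, add_smul, one_smul, sub_sub]

theorem det_smul_one_sub_inv_mul_eq_zero_iff {P Q : Matrix n n ℂ} (h : (P - Q).det ≠ 0) (k : ℂ) :
    (k • (1 : Matrix n n ℂ) - (P - Q)⁻¹ * Q).det = 0 ↔ (k • P - (k + 1) • Q).det = 0 := by
  rw [← sub_mul_smul_one_sub_inv_mul h, det_mul, mul_eq_zero, or_iff_right h]

theorem ne_zero_or_add_one_ne_zero (k : ℂ) : k ≠ 0 ∨ k + 1 ≠ 0 := by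
  by_cases hk : k = 0
  · simp [hk]
  · exact Or.inl hk

theorem inv_mul_mul_eq_mul_inv_mul {P Q S T U V : Matrix n n ℂ} (hP : P * V = U * S)
    (hQ : Q * V = U * T) (hPQ : (P - Q).det ≠ 0) (hST : (S - T).det ≠ 0) :
    (P - Q)⁻¹ * Q * V = V * ((S - T)⁻¹ * T) := by
  have hPQ' := isUnit_iff_ne_zero.2 hPQ
  have hST' := isUnit_iff_ne_zero.2 hST
  have h : (P - Q) * V = U * (S - T) := by rw [Matrix.sub_mul, Matrix.mul_sub, hP, hQ]
  calc (P - Q)⁻¹ * Q * V = (P - Q)⁻¹ * (U * (S - T) * ((S - T)⁻¹ * T)) := by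
        rw [Matrix.mul_assoc U, mul_nonsing_inv_cancel_left _ _ hST', Matrix.mul_assoc, hQ]
    _ = V * ((S - T)⁻¹ * T) := by
        rw [← h, Matrix.mul_assoc (P - Q), nonsing_inv_mul_cancel_left _ _ hPQ']

/-- A homogeneous generalized Sylvester equation whose pencils have no common eigenvalue has only
the trivial solution. -/
theorem DisjointPencils.eq_zero {P Q S T U V : Matrix n n ℂ} (h : DisjointPencils P Q S T)
    (hP : P * V = U * S) (hQ : Q * V = U * T) (hPQ : (P - Q).det ≠ 0) (hST : (S - T).det ≠ 0) :
    V = 0 ∧ U = 0 := by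
  have hV : V = 0 := by
    refine eq_zero_of_mul_eq_mul (inv_mul_mul_eq_mul_inv_mul hP hQ hPQ hST) fun k hk => ?_
    rw [det_smul_one_sub_inv_mul_eq_zero_iff hPQ] at hk
    rw [Ne, det_smul_one_sub_inv_mul_eq_zero_iff hST]
    exact h _ _ (ne_zero_or_add_one_ne_zero k) hk
  refine ⟨hV, ?_⟩
  have h0 : U * (S - T) = 0 := by
    rw [Matrix.mul_sub, ← hP, ← hQ, hV, Matrix.mul_zero, Matrix.mul_zero, sub_zero]
  exact (((isUnit_iff_isUnit_det _).2 (isUnit_iff_ne_zero.2 hST)).mul_left_eq_zero).1 h0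

/-- If the kernel of a singular matrix `V` is invariant under `N`, it contains an eigenvector
of `N`. -/
theorem exists_eigenvector_mem_ker {M N V : Matrix n n ℂ} (h : M * V = V * N) (hV : ¬IsUnit V) :
    ∃ (k : ℂ) (x : n → ℂ), x ≠ 0 ∧ V *ᵥ x = 0 ∧ N *ᵥ x = k • x := by
  have hdet : V.det = 0 := by
    rwa [isUnit_iff_isUnit_det, isUnit_iff_ne_zero, not_not] at hV
  obtain ⟨x, hx, hVx⟩ := exists_mulVec_eq_zero_iff.2 hdet
  let K : Submodule ℂ (n → ℂ) := LinearMap.ker V.mulVecLin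
  have hK : ∀ y ∈ K, N.mulVecLin y ∈ K := by
    intro y hy
    have hy' : V *ᵥ y = 0 := hy
    change V *ᵥ (N *ᵥ y) = 0
    rw [mulVec_mulVec, ← h, ← mulVec_mulVec, hy', mulVec_zero]
  have : Nontrivial K := ⟨⟨⟨x, hVx⟩, 0, fun e => hx (congrArg Subtype.val e)⟩⟩
  obtain ⟨k, hk⟩ := Module.End.exists_eigenvalue (N.mulVecLin.restrict hK)
  obtain ⟨y, hy⟩ := hk.exists_hasEigenvector
  exact ⟨k, y, fun e => hy.2 (Subtype.ext e), y.2, congrArg Subtype.val hy.apply_eq_smul⟩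

end Sylvester

/-! ### The theorem. -/

theorem mainTheorem1 (s : StarOp) (n : ℕ)
    (A B C U₁ U₂ V₁ V₂ T₁ T₂ : Matrix (Fin n) (Fin n) ℂ)
    (hfree : s.ReciprocalFree (pencilSpectrum (s.mat A) B))
    (h₁ : s.mat (zMatrix A B C) * Matrix.fromRows U₁ V₁ =
      Matrix.fromRows U₂ V₂ * s.mat T₁)
    (h₂ : zMatrix A B C * Matrix.fromRows U₁ V₁ = Matrix.fromRows U₂ V₂ * T₂) :
    (SpectrallyEquivalent (s.mat T₁) T₂ (s.mat B) A → V₁ = 0 ∧ U₂ = 0) ∧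
    (SpectrallyEquivalent (s.mat T₁) T₂ (s.mat A) B →
      (Matrix.fromRows U₁ V₁).rank = n →
        IsUnit V₁ ∧
        (IsUnit B →
          IsUnit U₂ ∧
          U₁ * V₁⁻¹ = -((s.mat U₂)⁻¹ * s.mat V₂) ∧
          A * (U₁ * V₁⁻¹) + s.mat (U₁ * V₁⁻¹) * B = C)) := by
  rw [zMatrix, s.mat_fromBlocks, fromBlocks_mul_fromRows, fromRows_mul, s.mat_zero, s.mat_neg,
    fromRows_inj.eq_iff] at h₁
  rw [zMatrix, fromBlocks_mul_fromRows, fromRows_mul, fromRows_inj.eq_iff] at h₂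
  simp only [Matrix.zero_mul, zero_add, Matrix.neg_mul] at h₁ h₂
  obtain ⟨hAV, hBU⟩ := h₁
  obtain ⟨hBV, hAU⟩ := h₂
  have hreg := hfree.det_sub_ne_zero
  have hdisj := hfree.disjointPencils
  rw [s.mat_mat] at hdisj
  have hreg' : (s.mat B - A).det ≠ 0 := by
    have e : s.mat B - A = s.mat (-(s.mat A - B)) := by rw [neg_sub, s.mat_sub, s.mat_mat]
    rw [e, s.det_mat, Ne, s.scalar_eq_zero_iff, det_neg]
    simpa using hreg
  refine ⟨fun hT => ?_, fun hT hrank => ?_⟩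
  · refine DisjointPencils.eq_zero (fun a b hab h => ?_) hAV hBV hreg
      (mt hT.det_sub_eq_zero_iff.1 hreg')
    exact mt (hT.det_eq_zero_iff hab).1 (hdisj a b hab h)
  have hregT : (s.mat T₁ - T₂).det ≠ 0 := mt hT.det_sub_eq_zero_iff.1 hreg
  have hV : IsUnit V₁ := by
    by_contra hV
    obtain ⟨k, x, hx, hVx, hNx⟩ :=
      exists_eigenvector_mem_ker (inv_mul_mul_eq_mul_inv_mul hAV hBV hreg hregT) hV
    have hTx : (k • s.mat T₁ - (k + 1) • T₂) *ᵥ x = 0 := by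
      rw [← sub_mul_smul_one_sub_inv_mul hregT, ← mulVec_mulVec,
        sub_mulVec (k • 1), hNx, smul_mulVec, one_mulVec, sub_self, mulVec_zero]
    have hUx : U₁ *ᵥ x ≠ 0 := by
      intro hUx
      refine hx (eq_zero_of_mulVec_eq_zero_of_rank_eq_card (W := fromRows U₁ V₁) (by simpa using hrank) ?_)
      rw [fromRows_mulVec, hUx, hVx]
      ext i
      cases i <;> rfl
    have hker : (k • s.mat B - (k + 1) • A) *ᵥ (U₁ *ᵥ x) = 0 := by
      have e : (k • s.mat B - (k + 1) • A) * U₁ = V₂ * (k • s.mat T₁ - (k + 1) • T₂) +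
          (k • s.mat C - (k + 1) • C) * V₁ := by
        rw [Matrix.mul_sub, Matrix.mul_smul, Matrix.mul_smul, ← hBU, ← hAU]
        simp only [Matrix.sub_mul, Matrix.smul_mul, smul_add, smul_neg]
        abel
      rw [mulVec_mulVec, e, add_mulVec, ← mulVec_mulVec, ← mulVec_mulVec, hTx, hVx, mulVec_zero,
        mulVec_zero, add_zero]
    have hk := ne_zero_or_add_one_ne_zero k
    exact hdisj k (k + 1) hk
      ((hT.det_eq_zero_iff hk).1 (exists_mulVec_eq_zero_iff.1 ⟨x, hx, hTx⟩))
      (exists_mulVec_eq_zero_iff.1 ⟨_, hUx, hker⟩)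
  refine ⟨hV, fun hB => ?_⟩
  have hUT : IsUnit (U₂ * T₂) := hBV ▸ hB.mul hV
  have hU : IsUnit U₂ := by
    rw [isUnit_iff_isUnit_det, det_mul] at hUT
    exact (isUnit_iff_isUnit_det _).2 (isUnit_of_mul_isUnit_left hUT)
  have hVd := (isUnit_iff_isUnit_det _).1 hV
  have hUd := (isUnit_iff_isUnit_det _).1 hU
  have hsUd := (isUnit_iff_isUnit_det _).1 (s.isUnit_mat hU)
  have hG : s.mat U₂ * U₁ + s.mat V₂ * V₁ = 0 := by
    set G := s.mat U₂ * U₁ + s.mat V₂ * V₁ with hGdef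
    have hsG : s.mat G = s.mat U₁ * U₂ + s.mat V₁ * V₂ := by
      rw [hGdef, s.mat_add, s.mat_mul, s.mat_mul, s.mat_mat, s.mat_mat]
    have hAV' : s.mat V₁ * A = T₁ * s.mat U₂ := by
      simpa only [s.mat_mul, s.mat_mat] using congrArg s.mat hAV
    have hBU' : s.mat U₁ * B - s.mat V₁ * C = T₁ * s.mat V₂ := by
      simpa only [← sub_eq_add_neg, s.mat_mul, s.mat_mat, s.mat_sub] using congrArg s.mat hBU
    -- Both sides equal `U₁^⋆BV₁ + V₁^⋆AU₁ - V₁^⋆CV₁`. Together with its ⋆-image this is a Sylvester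
    -- system in `(G, G^⋆)`.
    have h2 : T₁ * G = s.mat G * T₂ := by
      rw [hsG, hGdef, Matrix.mul_add, ← Matrix.mul_assoc, ← Matrix.mul_assoc, ← hAV', ← hBU',
        Matrix.add_mul, Matrix.mul_assoc _ U₂, Matrix.mul_assoc _ V₂, ← hBV, ← hAU]
      noncomm_ring
    have h1 : s.mat T₂ * G = s.mat G * s.mat T₁ := by
      simpa only [s.mat_mul, s.mat_mat] using (congrArg s.mat h2).symm
    have hfreeT : s.ReciprocalFree (pencilSpectrum (s.mat T₁) T₂) := by
      rw [show pencilSpectrum (s.mat T₁) T₂ = pencilSpectrum (s.mat A) B from hT]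
      exact hfree
    have hdisjT := hfreeT.disjointPencils
    rw [s.mat_mat] at hdisjT
    refine (DisjointPencils.eq_zero (fun a b hab h h' => hdisjT a b hab h' h) h1 h2 ?_ hregT).1
    have e : s.mat T₂ - T₁ = s.mat (-(s.mat T₁ - T₂)) := by rw [neg_sub, s.mat_sub, s.mat_mat]
    rw [e, s.det_mat, Ne, s.scalar_eq_zero_iff, det_neg]
    simpa using hregT
  have hX : U₁ * V₁⁻¹ = -((s.mat U₂)⁻¹ * s.mat V₂) := by
    have e : U₁ = -((s.mat U₂)⁻¹ * s.mat V₂) * V₁ := by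
      rw [Matrix.neg_mul, Matrix.mul_assoc, ← neg_eq_of_add_eq_zero_right hG, Matrix.mul_neg,
        neg_neg, nonsing_inv_mul_cancel_left _ _ hsUd]
    conv_lhs => rw [e]
    rw [mul_nonsing_inv_cancel_right _ _ hVd]
  refine ⟨hU, hX, ?_⟩
  have hXU : s.mat (U₁ * V₁⁻¹) * U₂ = -V₂ := by
    have e : s.mat U₂ * (U₁ * V₁⁻¹) = -s.mat V₂ := by
      rw [hX, Matrix.mul_neg, mul_nonsing_inv_cancel_left _ _ hsUd]
    simpa only [s.mat_mul, s.mat_mat, s.mat_neg] using congrArg s.mat e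
  -- Since `BV₁ = U₂T₂` and `X^⋆U₂ = -V₂`, the left side is `AU₁ - V₂T₂ = CV₁`.
  have hmul : (A * (U₁ * V₁⁻¹) + s.mat (U₁ * V₁⁻¹) * B) * V₁ = C * V₁ := by
    rw [Matrix.add_mul, Matrix.mul_assoc A, nonsing_inv_mul_cancel_right _ _ hVd,
      Matrix.mul_assoc _ B, hBV, ← Matrix.mul_assoc, hXU, Matrix.neg_mul, ← hAU]
    abel
  exact hV.mul_right_cancel hmul
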